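/- **Setting.** Let $X$ be an infinite dimensional separable real Banach space with a zero mean Gaussian (Borel probability) measure $\mu$, let $\mathrm{Im}:X\to H=L_2([0,1])$ be an injective continuous linear map, let $\nu=\mu\,\mathrm{Im}^{-1}$, and let $C_\nu:H\to H$ be its covariance operator, $\langle C_\nu h_1,h_2\rangle_H=\int_H\langle h,h_1\rangle_H\langle h,h_2\rangle_H\,\nu(dh)$. Let $(\eta_i)_{i\ge1}$ be an orthonormal sequence in $H$ with $C_\nu\eta_i=\lambda_i\eta_i$, where all eigenvalues $\lambda_i$ are positive. For an integer $r\ge1$ and positive numbers $K_0,\dots,K_r$, let $F_r$ be the class of functions $f:X\to\mathbb R$ that are $r-1$ times Fréchet differentiable, with $\sup_{x\in X}\|f^{(i)}(x)\|\le K_i$ for $0\le i\le r-1$ and $\|f^{(r-1)}(x)-f^{(r-1)}(y)\|\le K_r\|\mathrm{Im}(x-y)\|_H$ for all $x,y\in X$. Path integration is the problem of approximating $I(f)=\int_X f(x)\,\mu(dx)$ for $f\in F_r$. **Quantum algorithms.** A quantum query is given by integers $m',m'',m'''\ge0$, a set $Z\subseteq\{0,\dots,2^{m'}-1\}$ and maps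 $\tau:Z\to X$ and $\beta:\mathbb R\to\{0,\dots,2^{m''}-1\}$; for $f:X\to\mathbb R$ it is the unitary operator $Q_f$ on $m'+m''+m'''$ qubits with $Q_f|i\rangle|x\rangle|y\rangle=|i\rangle|x\oplus\beta(f(\tau(i)))\rangle|y\rangle$ if $i\in Z$, and $Q_f|i\rangle|x\rangle|y\rangle=|i\rangle|x\rangle|y\rangle$ otherwise, where $\oplus$ is addition modulo $2^{m''}$. A quantum algorithm consists of finitely many stages. The $\ell$th stage starts in a computational basis state that is a function of the measurement outcomes of the earlier stages, applies $U_{n_\ell}Q_fU_{n_\ell-1}Q_f\cdots U_1Q_fU_0$ with a query $Q$ and unitary operators $U_j$ that do not depend on $f$ (but may depend on $\ell$), and ends with a measurement in the computational basis. The output is a real function of all measurement outcomes, and the number of quantum queries is $\sum_\ell n_\ell$. Let $\mathrm{qq}(\varepsilon,F_r)$ be the minimal number of quantum queries of a quantum algorithm which, for every $f\in F_r$, outputs a number within $\varepsilon$ of $I(f)$ with probability at least $3/4$ ($\infty$ if there is none). **Theorem.** For every $\alpha\in(0,1)$, $$\lim_{\varepsilon\to0^+}\ \varepsilon^{1-\alpha}\,\mathrm{qq}(\varepsilon,F_r)=\infty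 .$$ -/

import Mathlib

open MeasureTheory ProbabilityTheory Filter Topology
open scoped ENNReal

namespace PathInt

noncomputable section

/-! ### The quantum query model for real-valued functions `f : D → ℝ` -/

/-- A quantum query. The computational basis consists of the states `|i⟩|x⟩|y⟩` with
`0 ≤ i < 2 ^ idxQubits`, `0 ≤ x < 2 ^ valQubits` and `0 ≤ y < 2 ^ workQubits`.
`node` assigns to an index `i` the point of `D` at which the function is evaluated
(`none` if the query does nothing for that index), and `code` turns a real function value
into a `valQubits`-bit number. -/
structure QuantumQuery (D : Type*) where
  idxQubits : ℕ
  valQubits : ℕ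
  workQubits : ℕ
  node : Fin (2 ^ idxQubits) → Option D
  code : ℝ → Fin (2 ^ valQubits)

namespace QuantumQuery

variable {D : Type*}

/-- The computational basis: it has `2 ^ (idxQubits + valQubits + workQubits)` elements. -/
abbrev BasisState (Q : QuantumQuery D) : Type :=
  Fin (2 ^ Q.idxQubits) × Fin (2 ^ Q.valQubits) × Fin (2 ^ Q.workQubits)

/-- `|i⟩|x⟩|y⟩ ↦ |i⟩|x ⊕ code (f (node i))⟩|y⟩`, where `⊕` is addition modulo
`2 ^ valQubits`; basis states whose index has no node are fixed. -/
def act (Q : QuantumQuery D) (f : D → ℝ) (s : Q.BasisState) : Q.BasisState :=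
  match Q.node s.1 with
  | none => s
  | some t => (s.1, s.2.1 + Q.code (f t), s.2.2)

/-- The matrix of the query operator `Q_f`, whose column `s` is the basis state `act f s`. -/
def matrix (Q : QuantumQuery D) (f : D → ℝ) : Matrix Q.BasisState Q.BasisState ℂ :=
  Matrix.of fun s t => if s = Q.act f t then 1 else 0

end QuantumQuery

/-- A quantum algorithm without measurement: a query `Q`, a number `n` of query calls, and
unitary operations `U 0, …, U n` independent of `f` (the values of `U` beyond `n` are not
used). -/
structure UnitaryStage (D : Type*) where
  Q : QuantumQuery D
  n : ℕ
  U : ℕ → Matrix.unitaryGroup Q.BasisState ℂ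

namespace UnitaryStage

variable {D : Type*}

/-- `U j * Q_f * U (j - 1) * ⋯ * U 1 * Q_f * U 0`. -/
def evolve (A : UnitaryStage D) (f : D → ℝ) : ℕ → Matrix A.Q.BasisState A.Q.BasisState ℂ
  | 0 => (A.U 0 : Matrix A.Q.BasisState A.Q.BasisState ℂ)
  | j + 1 => (A.U (j + 1) : Matrix A.Q.BasisState A.Q.BasisState ℂ) * A.Q.matrix f * A.evolve f j

/-- The probability of measuring the basis state `out` after running the stage on input `f`
from the basis state `inp`. -/
def prob (A : UnitaryStage D) (f : D → ℝ) (inp out : A.Q.BasisState) : ℝ :=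
  ‖A.evolve f A.n out inp‖ ^ 2

end UnitaryStage

/-- A quantum algorithm with finitely many measurements and a real output. The stages are run
one after the other; each of them starts in a basis state computed classically (by `start`)
from the outcomes of the measurements of all the earlier stages, and ends with a measurement
in the computational basis. The output is a function of all the measurement outcomes. -/
structure QuantumAlgorithm (D : Type*) where
  numStages : ℕ
  stage : Fin numStages → UnitaryStage D
  start : (l : Fin numStages) → ((j : Fin numStages) → j < l → (stage j).Q.BasisState) →
    (stage l).Q.BasisState
  output : ((l : Fin numStages) → (stage l).Q.BasisState) → ℝ

namespace QuantumAlgorithm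

variable {D : Type*}

/-- All the sequences of measurement outcomes. -/
abbrev Outcome (A : QuantumAlgorithm D) : Type :=
  (l : Fin A.numStages) → (A.stage l).Q.BasisState

/-- The total number of quantum queries. -/
def queries (A : QuantumAlgorithm D) : ℕ := ∑ l, (A.stage l).n

/-- The probability that the sequence of measurement outcomes is `ξ`, on input `f`. -/
def outcomeProb (A : QuantumAlgorithm D) (f : D → ℝ) (ξ : A.Outcome) : ℝ :=
  ∏ l, (A.stage l).prob f (A.start l fun j _ => ξ j) (ξ l)

open Classical in
/-- The probability that the output of `A` on input `f` lies in `S`. -/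
def outputProb (A : QuantumAlgorithm D) (f : D → ℝ) (S : Set ℝ) : ℝ :=
  ∑ ξ : A.Outcome, if A.output ξ ∈ S then A.outcomeProb f ξ else 0

/-- `A` computes an `ε`-approximation of `I f` with probability at least `3 / 4`,
for every `f ∈ F`. -/
def Approximates (A : QuantumAlgorithm D) (I : (D → ℝ) → ℝ) (F : Set (D → ℝ)) (ε : ℝ) : Prop :=
  ∀ f ∈ F, 3 / 4 ≤ A.outputProb f {a | |I f - a| ≤ ε}

end QuantumAlgorithm

/-- The minimal number of quantum queries of a quantum algorithm that computes an
`ε`-approximation of `I f` with probability at least `3 / 4` for all `f ∈ F`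
(`⊤` if there is no such algorithm). -/
def qq {D : Type*} (I : (D → ℝ) → ℝ) (F : Set (D → ℝ)) (ε : ℝ) : ℕ∞ :=
  ⨅ (A : QuantumAlgorithm D) (_ : A.Approximates I F ε), (A.queries : ℕ∞)

/-! ### Path integration -/

/-- The real Hilbert space `L₂([0,1])`. -/
abbrev L2I : Type := Lp ℝ 2 (volume : Measure unitInterval)

instance : MeasurableSpace L2I := borel L2I

instance : BorelSpace L2I := ⟨rfl⟩

section

variable {X : Type*} [NormedAddCommGroup X] [NormedSpace ℝ X]

/-- The class `F_r` (for `r ≥ 1`): functions on `X` that are `r - 1` times Fréchet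
differentiable, with the derivatives of order `i ≤ r - 1` bounded by `K i`, and such that the
derivative of order `r - 1` is Lipschitz with constant `K r` with respect to the norm of
`L₂([0,1])` (so that this derivative is continuous). -/
def classF (Im : X →L[ℝ] L2I) (r : ℕ) (K : ℕ → ℝ) : Set (X → ℝ) :=
  {f | ContDiff ℝ ((r - 1 : ℕ) : ℕ∞) f ∧
    (∀ i < r, ∀ x, ‖iteratedFDeriv ℝ i f x‖ ≤ K i) ∧
    ∀ x y, ‖iteratedFDeriv ℝ (r - 1) f x - iteratedFDeriv ℝ (r - 1) f y‖ ≤ K r * ‖Im (x - y)‖}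

/-- The path integral. -/
def pathIntegral [MeasurableSpace X] (μ : Measure X) (f : X → ℝ) : ℝ := ∫ x, f x ∂μ

end

end

end PathInt

/-! The proof is the polynomial method applied to parity. For every `d`, place disjointly supported
bumps at `n ^ d` lattice points in the first `d` eigen-coordinates, and switch each on or off by one
bit. Heights of order `n ^ (-r)` keep all these functions in `classF`. The Gaussian gives each small
box mass of order `n ^ (-d)`, so after equalizing the masses the integral is `w` times the number of
ones, with `w` of order `n ^ (-(r + d))` (`exists_pow_le_two_mul_queries`). An error below `w / 2`
reveals the parity of the bits. Output probabilities have degree at most `2 * queries` in the bits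
(`outputProb_mem_degreeLE`), and parity is orthogonal to all functions of degree less than the
number of bits (`sum_neg_one_pow_weight_mul_eq_zero`), so `n ^ d ≤ 2 * queries`. This is a lower
bound of order `ε ^ (-d / (r + d))`, whose exponent tends to `-1` as `d` grows. -/

namespace PathInt

/-! ### Degree of functions of bits, and orthogonality to parity -/

section BooleanDegree

variable {ι : Type*}

/-- The complex-valued functions of the bits `b i`, `i : ι`, of degree at most `k`: the span of
the functions that depend on at most `k` bits. -/
def degreeLE (ι : Type*) (k : ℕ) : Submodule ℂ ((ι → Bool) → ℂ) :=
  Submodule.span ℂ {g | ∃ s : Finset ι, s.card ≤ k ∧ DependsOn g (s : Set ι)}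

lemma mem_degreeLE_of_dependsOn {g : (ι → Bool) → ℂ} {k : ℕ} (s : Finset ι) (hs : s.card ≤ k)
    (hg : DependsOn g (s : Set ι)) : g ∈ degreeLE ι k :=
  Submodule.subset_span ⟨s, hs, hg⟩

lemma const_mem_degreeLE (k : ℕ) (c : ℂ) : (fun _ => c) ∈ degreeLE ι k :=
  mem_degreeLE_of_dependsOn ∅ (by simp) (by simpa using dependsOn_const c)

lemma mul_mem_degreeLE {k l : ℕ} {g h : (ι → Bool) → ℂ} (hg : g ∈ degreeLE ι k)
    (hh : h ∈ degreeLE ι l) : g * h ∈ degreeLE ι (k + l) := by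
  classical
  have := Submodule.mul_mem_mul hg hh
  rw [degreeLE, degreeLE, Submodule.span_mul_span] at this
  refine Submodule.span_mono ?_ this
  rintro _ ⟨g, ⟨s, hs, hgs⟩, h, ⟨t, ht, hht⟩, rfl⟩
  refine ⟨s ∪ t, (Finset.card_union_le _ _).trans (add_le_add hs ht), fun x y hxy => ?_⟩
  simp only [Pi.mul_apply]
  rw [hgs fun i hi => hxy i (by simp_all), hht fun i hi => hxy i (by simp_all)]

lemma prod_mem_degreeLE {κ : Type*} (s : Finset κ) (k : κ → ℕ) (g : κ → (ι → Bool) → ℂ)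
    (hg : ∀ i ∈ s, g i ∈ degreeLE ι (k i)) :
    ∏ i ∈ s, g i ∈ degreeLE ι (∑ i ∈ s, k i) := by
  classical
  induction s using Finset.induction_on with
  | empty => exact const_mem_degreeLE 0 1
  | insert a s ha ih =>
    rw [Finset.prod_insert ha, Finset.sum_insert ha]
    exact mul_mem_degreeLE (hg a (by simp)) (ih fun i hi => hg i (by simp [hi]))

lemma star_mem_degreeLE {k : ℕ} {g : (ι → Bool) → ℂ} (hg : g ∈ degreeLE ι k) :
    star g ∈ degreeLE ι k := by
  induction hg using Submodule.span_induction with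
  | mem g hg =>
    obtain ⟨s, hs, hgs⟩ := hg
    exact mem_degreeLE_of_dependsOn s hs fun x y hxy => congrArg star (hgs hxy)
  | zero => simp
  | add g h _ _ hg hh => rw [star_add]; exact add_mem hg hh
  | smul c g _ hg => rw [star_smul]; exact Submodule.smul_mem _ _ hg

variable [Fintype ι]

/-- The number of bits equal to one. -/
def weight (b : ι → Bool) : ℕ := ∑ i, (b i).toNat

/-- By linearity `g` may be taken to ignore some bit `i`. Flipping that bit pairs terms of opposite
sign. -/
lemma sum_neg_one_pow_weight_mul_eq_zero [DecidableEq ι] {k : ℕ} (hk : k < Fintype.card ι) {g : (ι → Bool) → ℂ}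
    (hg : g ∈ degreeLE ι k) : ∑ b, (-1 : ℂ) ^ weight b * g b = 0 := by
  induction hg using Submodule.span_induction with
  | zero => simp
  | add g h _ _ hg hh => simp [mul_add, Finset.sum_add_distrib, hg, hh]
  | smul c g _ hg =>
    simp only [Pi.smul_apply, smul_eq_mul, mul_left_comm _ c, ← Finset.mul_sum, hg, mul_zero]
  | mem g hg =>
    obtain ⟨s, hs, hgs⟩ := hg
    obtain ⟨i, hi⟩ : ∃ i, i ∉ s := by
      by_contra! h
      exact absurd (Finset.card_le_card (fun i _ => h i : Finset.univ ⊆ s))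
        (by simpa using hs.trans_lt hk)
    refine Finset.sum_involution (fun b _ => Function.update b i (!b i)) ?_ ?_ (by simp) (by simp)
    · intro b _
      have hgb : g (Function.update b i (!b i)) = g b :=
        hgs fun j hj => Function.update_of_ne (by rintro rfl; exact hi hj) _ _
      have hw : (-1 : ℂ) ^ weight (Function.update b i (!b i)) = -(-1) ^ weight b := by
        simp only [weight, ← Finset.prod_pow_eq_pow_sum]
        rw [← Finset.mul_prod_erase _ _ (Finset.mem_univ i),
          ← Finset.mul_prod_erase _ (fun j => (-1 : ℂ) ^ (b j).toNat) (Finset.mem_univ i),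
          Finset.prod_congr rfl fun j hj => by
            rw [Function.update_of_ne (Finset.ne_of_mem_erase hj)]]
        cases b i <;> simp
      rw [hgb, hw]; ring
    · intro b _ _ h
      have := congrFun h i
      simp at this

end BooleanDegree

/-! ### Outcome probabilities sum to one -/

section Unitarity

variable {D : Type*}

lemma QuantumQuery.act_injective (Q : QuantumQuery D) (f : D → ℝ) :
    Function.Injective (Q.act f) := by
  have hfst : ∀ s, (Q.act f s).1 = s.1 := by
    intro s
    unfold QuantumQuery.act
    split <;> rfl
  rintro ⟨i, x, y⟩ ⟨i', x', y'⟩ h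
  obtain rfl : i = i' := by simpa [hfst] using congrArg Prod.fst h
  unfold QuantumQuery.act at h
  cases hn : Q.node i with
  | none => simpa [hn] using h
  | some t => simpa [hn] using h

lemma QuantumQuery.matrix_mem_unitaryGroup (Q : QuantumQuery D) (f : D → ℝ) :
    Q.matrix f ∈ Matrix.unitaryGroup Q.BasisState ℂ := by
  rw [Matrix.mem_unitaryGroup_iff']
  ext s t
  simp [Matrix.mul_apply, Matrix.star_apply, QuantumQuery.matrix, Matrix.one_apply,
    (Q.act_injective f).eq_iff, eq_comm]

lemma UnitaryStage.evolve_mem_unitaryGroup (A : UnitaryStage D) (f : D → ℝ) (j : ℕ) :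
    A.evolve f j ∈ Matrix.unitaryGroup A.Q.BasisState ℂ := by
  induction j with
  | zero => exact (A.U 0).2
  | succ j ih => exact mul_mem (mul_mem (A.U (j + 1)).2 (A.Q.matrix_mem_unitaryGroup f)) ih

lemma UnitaryStage.sum_prob (A : UnitaryStage D) (f : D → ℝ) (inp : A.Q.BasisState) :
    ∑ out, A.prob f inp out = 1 := by
  have h := congrFun (congrFun
    (Matrix.mem_unitaryGroup_iff'.1 (A.evolve_mem_unitaryGroup f A.n)) inp) inp
  rw [Matrix.mul_apply, Matrix.one_apply_eq] at h
  have : ((∑ out, A.prob f inp out : ℝ) : ℂ) = 1 := by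
    rw [← h]
    push_cast
    refine Finset.sum_congr rfl fun out _ => ?_
    rw [UnitaryStage.prob, Matrix.star_apply, Complex.star_def, Complex.conj_mul']
    norm_cast
  exact_mod_cast this

/-- The total mass of a probability distribution on sequences that is given by the conditional
distributions of each entry given the earlier ones. -/
lemma sum_prod_conditional_eq_one (n : ℕ) (β : Fin n → Type*) [∀ l, Fintype (β l)]
    (p : (l : Fin n) → ((j : Fin n) → j < l → β j) → β l → ℝ)
    (hp : ∀ l h, ∑ x, p l h x = 1) :
    ∑ ξ : (l : Fin n) → β l, ∏ l, p l (fun j _ => ξ j) (ξ l) = 1 := by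
  induction n with
  | zero => simp
  | succ n ih =>
    rw [← (Fin.consEquiv β).sum_comp, Fintype.sum_prod_type]
    rw [← hp 0 fun j hj => absurd hj (Fin.not_lt_zero j)]
    refine Finset.sum_congr rfl fun x _ => ?_
    -- Puts the fixed first outcome `x` in front of a history of the later stages.
    let past (l : Fin n) (h : (j : Fin n) → j < l → β j.succ) (j : Fin (n + 1)) :
        j < l.succ → β j :=
      Fin.cases (motive := fun j => j < l.succ → β j) (fun _ => x)
        (fun j hj => h j (Fin.succ_lt_succ_iff.1 hj)) j
    have key := ih (fun l => β l.succ) (fun l h y => p l.succ (past l h) y) (fun l h => hp _ _)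
    have hpast : ∀ (l : Fin n) (ξ : (l : Fin n) → β l.succ),
        past l (fun j _ => ξ j) = fun j _ => (Fin.cons x ξ : (l : Fin (n + 1)) → β l) j := by
      intro l ξ
      funext j hj
      cases j using Fin.cases <;> rfl
    simp only [hpast] at key
    have hzero : ∀ h h' : (j : Fin (n + 1)) → j < 0 → β j, h = h' := fun h h' =>
      funext fun j => funext fun hj => absurd hj (Fin.not_lt_zero j)
    simp only [Fin.consEquiv_apply, Fin.prod_univ_succ, Fin.cons_succ, Fin.cons_zero]
    rw [Finset.sum_congr rfl fun ξ _ => by rw [hzero (fun j _ => Fin.cons x ξ j)],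
      ← Finset.mul_sum, key, mul_one]

lemma QuantumAlgorithm.outcomeProb_nonneg (A : QuantumAlgorithm D) (f : D → ℝ) (ξ : A.Outcome) :
    0 ≤ A.outcomeProb f ξ :=
  Finset.prod_nonneg fun _ _ => sq_nonneg _

lemma QuantumAlgorithm.sum_outcomeProb (A : QuantumAlgorithm D) (f : D → ℝ) :
    ∑ ξ, A.outcomeProb f ξ = 1 :=
  sum_prod_conditional_eq_one A.numStages (fun l => (A.stage l).Q.BasisState)
    (fun l h => (A.stage l).prob f (A.start l h)) fun l _ => (A.stage l).sum_prob f _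

lemma QuantumAlgorithm.outputProb_mono (A : QuantumAlgorithm D) (f : D → ℝ) {S T : Set ℝ}
    (h : S ⊆ T) : A.outputProb f S ≤ A.outputProb f T := by
  refine Finset.sum_le_sum fun ξ _ => ?_
  have := A.outcomeProb_nonneg f ξ
  by_cases hS : A.output ξ ∈ S
  · simp [hS, h hS]
  · simp only [hS, if_false]; split_ifs <;> simp [this]

lemma QuantumAlgorithm.outputProb_add_le_one (A : QuantumAlgorithm D) (f : D → ℝ) {S T : Set ℝ}
    (h : Disjoint S T) : A.outputProb f S + A.outputProb f T ≤ 1 := by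
  rw [← A.sum_outcomeProb f, outputProb, outputProb, ← Finset.sum_add_distrib]
  refine Finset.sum_le_sum fun ξ _ => ?_
  have := A.outcomeProb_nonneg f ξ
  by_cases hS : A.output ξ ∈ S
  · simp [hS, Set.disjoint_left.1 h hS]
  · simp only [hS, if_false]; split_ifs <;> simp [this]

end Unitarity

/-! ### The polynomial method for multi-stage algorithms -/

section PolynomialMethod

variable {D ι : Type*} {f : (ι → Bool) → D → ℝ}

/-- A column of the query matrix involves `f` at one node only, and `hf` says that this value is
governed by at most one bit. -/
lemma QuantumQuery.matrix_mem_degreeLE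
    (hf : ∀ t, ∃ s : Finset ι, s.card ≤ 1 ∧ DependsOn (fun b => f b t) (s : Set ι))
    (Q : QuantumQuery D) (s t : Q.BasisState) :
    (fun b => Q.matrix (f b) s t) ∈ degreeLE ι 1 := by
  cases hn : Q.node t.1 with
  | none =>
    simp only [QuantumQuery.matrix, QuantumQuery.act, hn, Matrix.of_apply]
    exact const_mem_degreeLE _ _
  | some u =>
    obtain ⟨v, hv, hfv⟩ := hf u
    refine mem_degreeLE_of_dependsOn v hv fun x y hxy => ?_
    have : f x u = f y u := hfv hxy
    simp only [QuantumQuery.matrix, QuantumQuery.act, hn, Matrix.of_apply, this]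

lemma UnitaryStage.evolve_mem_degreeLE
    (hf : ∀ t, ∃ s : Finset ι, s.card ≤ 1 ∧ DependsOn (fun b => f b t) (s : Set ι))
    (A : UnitaryStage D) (j : ℕ) (s t : A.Q.BasisState) :
    (fun b => A.evolve (f b) j s t) ∈ degreeLE ι j := by
  induction j generalizing s t with
  | zero => exact const_mem_degreeLE _ _
  | succ j ih =>
    have : (fun b => A.evolve (f b) (j + 1) s t) =
        ∑ u, (∑ v, (A.U (j + 1) : Matrix A.Q.BasisState A.Q.BasisState ℂ) s v •
          (fun b => A.Q.matrix (f b) v u)) * fun b => A.evolve (f b) j u t := by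
      funext b
      simp [UnitaryStage.evolve, Matrix.mul_apply]
    rw [this, add_comm j 1]
    exact sum_mem fun u _ => mul_mem_degreeLE (sum_mem fun v _ =>
      Submodule.smul_mem _ _ (A.Q.matrix_mem_degreeLE hf v u)) (ih u t)

lemma UnitaryStage.prob_mem_degreeLE
    (hf : ∀ t, ∃ s : Finset ι, s.card ≤ 1 ∧ DependsOn (fun b => f b t) (s : Set ι))
    (A : UnitaryStage D) (s t : A.Q.BasisState) :
    (fun b => (A.prob (f b) s t : ℂ)) ∈ degreeLE ι (2 * A.n) := by
  have : (fun b => (A.prob (f b) s t : ℂ)) =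
      star (fun b => A.evolve (f b) A.n t s) * fun b => A.evolve (f b) A.n t s := by
    funext b
    simp [UnitaryStage.prob, Complex.conj_mul']
  rw [this, two_mul]
  exact mul_mem_degreeLE (star_mem_degreeLE (A.evolve_mem_degreeLE hf _ _ _))
    (A.evolve_mem_degreeLE hf _ _ _)

/-- For a fixed outcome sequence the starting states do not depend on the bits, so the degrees of
the stages, twice their query counts, simply add up. -/
lemma QuantumAlgorithm.outputProb_mem_degreeLE
    (hf : ∀ t, ∃ s : Finset ι, s.card ≤ 1 ∧ DependsOn (fun b => f b t) (s : Set ι))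
    (A : QuantumAlgorithm D) (S : Set ℝ) :
    (fun b => (A.outputProb (f b) S : ℂ)) ∈ degreeLE ι (2 * A.queries) := by
  classical
  have : (fun b => (A.outputProb (f b) S : ℂ)) =
      ∑ ξ : A.Outcome with A.output ξ ∈ S,
        ∏ l, fun b => ((A.stage l).prob (f b) (A.start l fun j _ => ξ j) (ξ l) : ℂ) := by
    funext b
    simp [outputProb, outcomeProb, Finset.sum_filter, Finset.sum_apply, Finset.prod_apply,
      apply_ite]
  rw [this, queries, Finset.mul_sum]
  exact sum_mem fun ξ _ => prod_mem_degreeLE _ _ _ fun l _ =>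
    (A.stage l).prob_mem_degreeLE hf _ _

/-- Approximating `w * weight b` to within less than `w / 2` determines the parity of the bits,
which takes at least half as many queries as there are bits. -/
theorem QuantumAlgorithm.Approximates.card_le_two_mul_queries [Fintype ι]
    (hf : ∀ t, ∃ s : Finset ι, s.card ≤ 1 ∧ DependsOn (fun b => f b t) (s : Set ι))
    {I : (D → ℝ) → ℝ} {F : Set (D → ℝ)} (hF : ∀ b, f b ∈ F) {w ε : ℝ}
    (hI : ∀ b, I (f b) = w * weight b) (hε : 2 * ε < w)
    {A : QuantumAlgorithm D} (hA : A.Approximates I F ε) :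
    Fintype.card ι ≤ 2 * A.queries := by
  classical
  by_contra! hlt
  -- Outputs compatible with an even, respectively odd, weight; these are disjoint because `2 * ε <
  -- w`.
  let S : Set ℝ := {a | ∃ k : ℕ, Even k ∧ |w * k - a| ≤ ε}
  let T : Set ℝ := {a | ∃ k : ℕ, Odd k ∧ |w * k - a| ≤ ε}
  have hST : Disjoint S T := by
    rw [Set.disjoint_left]
    rintro a ⟨k, hk, hka⟩ ⟨l, hl, hla⟩
    have hne : (k : ℤ) - l ≠ 0 := by
      intro h
      obtain rfl : k = l := by omega
      exact (Nat.not_even_iff_odd.2 hl) hk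
    have h1 : (1 : ℝ) ≤ |(k : ℝ) - l| := by exact_mod_cast Int.one_le_abs hne
    have h2 : w * |(k : ℝ) - l| ≤ 2 * ε := by
      have hw : 0 ≤ w := by linarith [(abs_nonneg _).trans hka]
      rw [← abs_of_nonneg hw, ← abs_mul]
      calc |w * ((k : ℝ) - l)| = |(w * k - a) - (w * l - a)| := by ring_nf
        _ ≤ _ := (abs_sub _ _).trans (by linarith)
    nlinarith [(abs_nonneg _).trans hka]
  have hzero := sum_neg_one_pow_weight_mul_eq_zero hlt
    (sub_mem (A.outputProb_mem_degreeLE hf S) (A.outputProb_mem_degreeLE hf T))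
  have hreal : ∑ b, (-1 : ℝ) ^ weight b *
      (A.outputProb (f b) S - A.outputProb (f b) T) = 0 := by
    simp only [Pi.sub_apply] at hzero
    exact_mod_cast hzero
  -- Every term is positive: the set of the correct parity has probability at least `3 / 4`, the
  -- other at most `1 / 4`.
  refine absurd hreal (ne_of_gt (Finset.sum_pos (fun b _ => ?_) Finset.univ_nonempty))
  have happ := hA (f b) (hF b)
  have hdis := A.outputProb_add_le_one (f b) hST
  rw [hI] at happ
  rcases Nat.even_or_odd (weight b) with hb | hb
  · have : A.outputProb (f b) {a | |w * weight b - a| ≤ ε} ≤ A.outputProb (f b) S :=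
      A.outputProb_mono (f b) fun a ha => ⟨weight b, hb, ha⟩
    rw [hb.neg_one_pow]; linarith
  · have : A.outputProb (f b) {a | |w * weight b - a| ≤ ε} ≤ A.outputProb (f b) T :=
      A.outputProb_mono (f b) fun a ha => ⟨weight b, hb, ha⟩
    rw [hb.neg_one_pow]; linarith

end PolynomialMethod

/-! ### Disjoint bumps on a lattice -/

section LatticeSum

variable {d : ℕ}

/-- An index `j`, as an integer point of `ℝ ^ d`. -/
def latticePoint {n : ℕ} (j : Fin d → Fin n) : Fin d → ℝ := fun i => ((j i : ℕ) : ℝ)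

lemma one_le_norm_latticePoint_sub {n : ℕ} {j k : Fin d → Fin n} (h : j ≠ k) :
    1 ≤ ‖latticePoint j - latticePoint k‖ := by
  obtain ⟨i, hi⟩ := Function.ne_iff.1 h
  refine le_trans ?_ (norm_le_pi_norm (latticePoint j - latticePoint k) i)
  have hne : ((j i : ℕ) : ℤ) - ((k i : ℕ) : ℤ) ≠ 0 := by
    intro h0
    exact hi (Fin.ext (by omega))
  simp only [latticePoint, Pi.sub_apply, Real.norm_eq_abs]
  exact_mod_cast Int.one_le_abs hne

/-- A smooth bump function on `ℝ ^ d` with the maximum norm. -/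
noncomputable def bump (d : ℕ) : ContDiffBump (0 : Fin d → ℝ) :=
  -- The outer radius is below `1 / 2`, so unit-spaced translates have disjoint closed supports.
  ⟨1 / 6, 1 / 3, by norm_num, by norm_num⟩

/-- A linear combination of translates of `bump d` with disjoint supports. -/
noncomputable def latticeSum {n : ℕ} (c : (Fin d → Fin n) → ℝ) (y : Fin d → ℝ) : ℝ :=
  ∑ j, c j * bump d (y - latticePoint j)

/-- At most one translate of `bump d` is nonzero near any given point. -/
lemma exists_card_le_one_forall_notMem (n : ℕ) (y : Fin d → ℝ) :
    ∃ s : Finset (Fin d → Fin n), s.card ≤ 1 ∧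
      ∀ j ∉ s, y - latticePoint j ∉ tsupport (bump d) := by
  classical
  refine ⟨Finset.univ.filter fun j => ‖y - latticePoint j‖ ≤ 1 / 3, ?_, ?_⟩
  · refine Finset.card_le_one.2 fun j hj k hk => ?_
    simp only [Finset.mem_filter, Finset.mem_univ, true_and] at hj hk
    by_contra hjk
    have h1 := one_le_norm_latticePoint_sub hjk
    have h2 : ‖latticePoint j - latticePoint k‖ ≤
        ‖y - latticePoint k‖ + ‖y - latticePoint j‖ := by
      rw [show latticePoint j - latticePoint k =
        (y - latticePoint k) - (y - latticePoint j) by abel]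
      exact norm_sub_le _ _
    linarith
  · intro j hj
    rw [(bump d).tsupport_eq]
    simpa [bump] using hj

lemma contDiff_latticeSum {n : ℕ} (c : (Fin d → Fin n) → ℝ) (m : ℕ) :
    ContDiff ℝ m (latticeSum c) := by
  refine ContDiff.sum fun j _ => contDiff_const.mul ?_
  exact (bump d).contDiff.comp (contDiff_id.sub contDiff_const)

lemma exists_norm_iteratedFDeriv_bump_le (d r : ℕ) :
    ∃ M, 0 < M ∧ ∀ i ≤ r, ∀ y, ‖iteratedFDeriv ℝ i (bump d) y‖ ≤ M := by
  have h : ∀ i, ∃ C, ∀ y, ‖iteratedFDeriv ℝ i (bump d) y‖ ≤ C := fun i =>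
    ((bump d).contDiff (n := i).continuous_iteratedFDeriv le_rfl).bounded_above_of_compact_support
      ((bump d).hasCompactSupport.iteratedFDeriv i)
  choose C hC using h
  have hC0 : ∀ i, 0 ≤ C i := fun i => (norm_nonneg _).trans (hC i 0)
  refine ⟨1 + ∑ i ∈ Finset.range (r + 1), C i,
    by linarith [Finset.sum_nonneg fun i (_ : i ∈ Finset.range (r + 1)) => hC0 i],
    fun i hi y => (hC i y).trans ?_⟩
  linarith [Finset.single_le_sum (fun i _ => hC0 i) (Finset.mem_range.2 (Nat.lt_succ_of_le hi))]

/-- Near any point at most one summand survives, so the bound for one bump serves for all `n` and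
`c`. -/
lemma norm_iteratedFDeriv_latticeSum_le {n i : ℕ} {c : (Fin d → Fin n) → ℝ} (hc : ∀ j, |c j| ≤ 1)
    {M : ℝ} (hM : ∀ y, ‖iteratedFDeriv ℝ i (bump d) y‖ ≤ M) (y : Fin d → ℝ) :
    ‖iteratedFDeriv ℝ i (latticeSum c) y‖ ≤ M := by
  obtain ⟨s, hs, hsy⟩ := exists_card_le_one_forall_notMem n y
  have hM0 : 0 ≤ M := (norm_nonneg _).trans (hM 0)
  have hb : ∀ j, ContDiff ℝ i fun y => bump d (y - latticePoint (n := n) j) := fun j =>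
    (bump d).contDiff.comp (contDiff_id.sub contDiff_const)
  have hD : iteratedFDeriv ℝ i (latticeSum c) y =
      ∑ j, c j • iteratedFDeriv ℝ i (bump d) (y - latticePoint j) := by
    unfold latticeSum
    rw [iteratedFDeriv_fun_sum_apply fun j _ => (contDiff_const.mul (hb j)).contDiffAt]
    refine Finset.sum_congr rfl fun j _ => ?_
    rw [← iteratedFDeriv_comp_sub, ← iteratedFDeriv_const_smul_apply (hb j).contDiffAt]
    rfl
  rw [hD, ← Finset.sum_subset (Finset.subset_univ s) fun j _ hj => by
    rw [image_eq_zero_of_notMem_tsupport fun h => hsy j hj (tsupport_iteratedFDeriv_subset i h),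
      smul_zero]]
  calc _ ≤ ∑ j ∈ s, ‖c j • iteratedFDeriv ℝ i (bump d) (y - latticePoint j)‖ := norm_sum_le _ _
    _ ≤ ∑ j ∈ s, M := Finset.sum_le_sum fun j _ => by
        rw [norm_smul, Real.norm_eq_abs]
        exact (mul_le_mul (hc j) (hM _) (norm_nonneg _) zero_le_one).trans_eq (one_mul M)
    _ = s.card * M := by simp
    _ ≤ 1 * M := by gcongr; exact_mod_cast hs
    _ = M := one_mul M

end LatticeSum

/-! ### Rescaled functions in the class -/

section ClassF

variable {X E : Type*} [NormedAddCommGroup X] [NormedSpace ℝ X]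
  [NormedAddCommGroup E] [NormedSpace ℝ E]

/-- A smooth function with bounded derivatives, composed with a linear map that is bounded by
`Im` and rescaled, belongs to the class `F_r`. -/
lemma rescaled_comp_mem_classF {Im : X →L[ℝ] L2I} {P : X →L[ℝ] E} (hP : ∀ x, ‖P x‖ ≤ ‖Im x‖)
    {r : ℕ} (hr : 1 ≤ r) {K : ℕ → ℝ} {G : E → ℝ} (hG : ContDiff ℝ r G) {M a : ℝ}
    (hM : ∀ i ≤ r, ∀ y, ‖iteratedFDeriv ℝ i G y‖ ≤ M) (ha : 0 ≤ a)
    (hK : ∀ i ≤ r, a * M * (1 + ‖Im‖) ^ r ≤ K i) {n : ℕ} (hn : 1 ≤ n) :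
    (fun x => a / n ^ r * G ((n : ℝ) • P x)) ∈ classF Im r K := by
  have hM0 : 0 ≤ M := (norm_nonneg _).trans (hM 0 (Nat.zero_le r) 0)
  have hn1 : (1 : ℝ) ≤ n := by exact_mod_cast hn
  have hn0 : (0 : ℝ) < n := by linarith
  set L : X →L[ℝ] E := (n : ℝ) • P with hL
  have hPn : ‖P‖ ≤ ‖Im‖ := P.opNorm_le_bound (norm_nonneg _) fun x =>
    (hP x).trans (Im.le_opNorm x)
  have hLn : ‖L‖ ≤ n * (1 + ‖Im‖) := by
    rw [hL, norm_smul, Real.norm_of_nonneg hn0.le]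
    gcongr
    linarith
  -- Since `1 + ‖Im‖ ≥ 1`, the single constant `(1 + ‖Im‖) ^ r` covers all orders.
  have hpow : ∀ i ≤ r, (n * (1 + ‖Im‖)) ^ i ≤ n ^ i * (1 + ‖Im‖) ^ r := fun i hi => by
    rw [mul_pow]
    gcongr
    linarith [norm_nonneg Im]
  have hf : (fun x => a / n ^ r * G ((n : ℝ) • P x)) = (a / n ^ r) • (G ∘ L) := rfl
  have hD : ∀ i ≤ r, ∀ x, iteratedFDeriv ℝ i ((a / n ^ r) • (G ∘ L)) x =
      (a / n ^ r) • (iteratedFDeriv ℝ i G (L x)).compContinuousLinearMap fun _ => L := by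
    intro i hi x
    have hi' : (i : WithTop ℕ∞) ≤ r := by exact_mod_cast hi
    rw [iteratedFDeriv_const_smul_apply ((hG.of_le hi').comp L.contDiff).contDiffAt,
      L.iteratedFDeriv_comp_right hG x hi']
  have hcomp : ∀ i ≤ r, ∀ B : ContinuousMultilinearMap ℝ (fun _ : Fin i => E) ℝ,
      ‖B.compContinuousLinearMap fun _ => L‖ ≤ ‖B‖ * (n ^ i * (1 + ‖Im‖) ^ r) := by
    intro i hi B
    refine (B.norm_compContinuousLinearMap_le _).trans ?_
    rw [Finset.prod_const, Finset.card_univ, Fintype.card_fin]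
    gcongr
    exact (pow_le_pow_left₀ (norm_nonneg _) hLn i).trans (hpow i hi)
  have ha' : 0 ≤ a / n ^ r := by positivity
  have hIm : 0 ≤ (1 + ‖Im‖) ^ r := by positivity
  rw [hf]
  refine ⟨?_, ?_, ?_⟩
  · refine contDiff_const.smul ((hG.of_le ?_).comp L.contDiff)
    exact_mod_cast Nat.sub_le r 1
  · intro i hi x
    rw [hD i hi.le, norm_smul, Real.norm_of_nonneg ha']
    calc a / n ^ r * _ ≤ a / n ^ r * (M * (n ^ r * (1 + ‖Im‖) ^ r)) := by
          gcongr
          refine (hcomp i hi.le _).trans ?_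
          gcongr
          exact hM i hi.le _
      _ = a * M * (1 + ‖Im‖) ^ r := by field_simp
      _ ≤ K i := hK i hi.le
  · intro x y
    rw [hD _ (Nat.sub_le r 1), hD _ (Nat.sub_le r 1), ← smul_sub, norm_smul,
      Real.norm_of_nonneg ha']
    have hsub : ((iteratedFDeriv ℝ (r - 1) G (L x)).compContinuousLinearMap fun _ => L) -
        ((iteratedFDeriv ℝ (r - 1) G (L y)).compContinuousLinearMap fun _ => L) =
        (iteratedFDeriv ℝ (r - 1) G (L x) - iteratedFDeriv ℝ (r - 1) G (L y)
          ).compContinuousLinearMap fun _ => L := rfl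
    -- The mean value inequality with the derivative of order `r`. The factor `n` from `hLxy`
    -- completes `n ^ (r - 1)` to `n ^ r`.
    have hlip : ‖iteratedFDeriv ℝ (r - 1) G (L x) - iteratedFDeriv ℝ (r - 1) G (L y)‖ ≤
        M * ‖L x - L y‖ := by
      refine convex_univ.norm_image_sub_le_of_norm_fderiv_le (𝕜 := ℝ) (fun z _ => ?_)
        (fun z _ => ?_) (Set.mem_univ _) (Set.mem_univ _)
      · exact (hG.differentiable_iteratedFDeriv (by exact_mod_cast (by omega : r - 1 < r))) z
      · rw [norm_fderiv_iteratedFDeriv]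
        exact hM _ (by omega) z
    have hLxy : ‖L x - L y‖ ≤ n * ‖Im (x - y)‖ := by
      rw [← map_sub, hL, smul_apply, norm_smul, Real.norm_of_nonneg hn0.le]
      gcongr
      exact hP _
    rw [hsub]
    calc a / n ^ r * _ ≤ a / n ^ r *
          (M * (n * ‖Im (x - y)‖) * (n ^ (r - 1) * (1 + ‖Im‖) ^ r)) := by
          gcongr
          refine (hcomp _ (Nat.sub_le r 1) _).trans ?_
          gcongr
          exact hlip.trans (by gcongr)
      _ = a * M * (1 + ‖Im‖) ^ r * ‖Im (x - y)‖ * (n * n ^ (r - 1) / n ^ r) := by ring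
      _ = a * M * (1 + ‖Im‖) ^ r * ‖Im (x - y)‖ := by
          rw [mul_pow_sub_one (by omega), div_self (by positivity), mul_one]
      _ ≤ K r * ‖Im (x - y)‖ := by
          gcongr
          exact hK r le_rfl

end ClassF

/-! ### Gaussian mass of small boxes -/

section GaussianSmallBoxes

/-- On `[-1, 1]` the centred density is at least its value at `1`, which serves as `κ`. -/
lemma exists_le_gaussianReal_Icc {v : NNReal} (hv : v ≠ 0) :
    ∃ κ : ℝ, 0 < κ ∧ ∀ a b : ℝ, -1 ≤ a → b ≤ 1 →
      ENNReal.ofReal (κ * (b - a)) ≤ gaussianReal 0 v (Set.Icc a b) := by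
  refine ⟨gaussianPDFReal 0 v 1, gaussianPDFReal_pos 0 v 1 hv, fun a b ha hb => ?_⟩
  have hle : ∀ x ∈ Set.Icc a b, ENNReal.ofReal (gaussianPDFReal 0 v 1) ≤ gaussianPDF 0 v x := by
    intro x hx
    refine ENNReal.ofReal_le_ofReal ?_
    have hx1 : x ^ 2 ≤ 1 := by
      rw [sq_le_one_iff_abs_le_one, abs_le]
      exact ⟨ha.trans hx.1, hx.2.trans hb⟩
    simp only [gaussianPDFReal, sub_zero]
    gcongr (√(2 * Real.pi * v))⁻¹ * Real.exp (-?_ / (2 * v))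
    simpa only [one_pow] using hx1
  rw [gaussianReal_apply 0 hv, ENNReal.ofReal_mul (gaussianPDFReal_nonneg 0 v 1),
    ← Real.volume_Icc, ← setLIntegral_const]
  exact setLIntegral_mono' measurableSet_Icc hle

variable {X : Type*} [NormedAddCommGroup X] [NormedSpace ℝ X]

/-- The first `d` coordinates of `Im x` with respect to the orthonormal sequence `η`. -/
noncomputable def coordMap (Im : X →L[ℝ] L2I) (η : ℕ → L2I) (d : ℕ) : X →L[ℝ] (Fin d → ℝ) :=
  ContinuousLinearMap.pi fun i => (innerSL ℝ (η i)).comp Im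

lemma coordMap_apply (Im : X →L[ℝ] L2I) (η : ℕ → L2I) (d : ℕ) (x : X) (i : Fin d) :
    coordMap Im η d x i = inner ℝ (η i) (Im x) := rfl

lemma norm_coordMap_le (Im : X →L[ℝ] L2I) {η : ℕ → L2I} (hη : Orthonormal ℝ η) (d : ℕ) (x : X) :
    ‖coordMap Im η d x‖ ≤ ‖Im x‖ := by
  refine (pi_norm_le_iff_of_nonneg (norm_nonneg _)).2 fun i => ?_
  rw [coordMap_apply]
  simpa [hη.1 i] using norm_inner_le_norm (𝕜 := ℝ) (η i) (Im x)

variable [MeasurableSpace X] [BorelSpace X] {μ : Measure X}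

lemma integral_inner_mul_inner {Im : X →L[ℝ] L2I} {η : ℕ → L2I} (hη : Orthonormal ℝ η)
    {eig : ℕ → ℝ} (hC : ∀ i, covarianceOperator (μ.map Im) (η i) = eig i • η i)
    (heig : ∀ i, 0 < eig i) (i j : ℕ) :
    ∫ x, inner ℝ (η i) (Im x) * inner ℝ (η j) (Im x) ∂μ = if i = j then eig i else 0 := by
  -- Without second moments `covarianceOperator` is zero by convention, contradicting `0 < eig 0`.
  have hmem : MemLp id 2 (μ.map Im) := by
    by_contra h
    have h0 := hC 0
    rw [covarianceOperator_of_not_memLp h, zero_apply] at h0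
    exact (smul_ne_zero (heig 0).ne' (hη.ne_zero 0)) h0.symm
  have h := covarianceOperator_inner hmem (η i) (η j)
  rw [hC, integral_map (by fun_prop) (by fun_prop), inner_smul_left,
    orthonormal_iff_ite.1 hη] at h
  rw [← h]
  simp

/-- The distribution of the first `d` coordinates gives each of the small boxes around the points
of a grid of mesh `1 / n` a probability of the order of their volume. -/
lemma exists_le_measureReal_coordMap [TopologicalSpace.SeparableSpace X] [IsGaussian μ]
    (hμ : ∀ L : StrongDual ℝ X, ∫ x, L x ∂μ = 0)
    {Im : X →L[ℝ] L2I} {η : ℕ → L2I} (hη : Orthonormal ℝ η)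
    {eig : ℕ → ℝ} (hC : ∀ i, covarianceOperator (μ.map Im) (η i) = eig i • η i)
    (heig : ∀ i, 0 < eig i) (d : ℕ) :
    ∃ c : ℝ, 0 < c ∧ ∀ (n : ℕ) (_ : 1 ≤ n) (j : Fin d → Fin n),
      c / n ^ d ≤ μ.real {x | ‖(n : ℝ) • coordMap Im η d x - latticePoint j‖ ≤ 1 / 6} := by
  have : SecondCountableTopology X := UniformSpace.secondCountable_of_separable X
  let L : Fin d → StrongDual ℝ X := fun i => (innerSL ℝ (η i)).comp Im
  have hLapp : ∀ i x, L i x = inner ℝ (η i) (Im x) := fun i x => rfl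
  have hlaw : HasGaussianLaw (fun x i => L i x) μ :=
    ⟨inferInstanceAs (IsGaussian (μ.map (coordMap Im η d)))⟩
  have hcov : ∀ i j, i ≠ j → cov[L i, L j; μ] = 0 := by
    intro i j hij
    simp only [covariance, hμ, sub_zero]
    simp only [hLapp]
    rw [integral_inner_mul_inner hη hC heig, if_neg (by simpa [Fin.ext_iff] using hij)]
  -- Jointly Gaussian and uncorrelated coordinates are independent, so box probabilities factor.
  have hind : iIndepFun (fun i => ⇑(L i)) μ := hlaw.iIndepFun_of_covariance_eq_zero hcov
  have hvar : ∀ i : Fin d, Var[L i; μ] = eig i := by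
    intro i
    rw [variance_eq_integral (by fun_prop)]
    simp only [hμ, sub_zero, sq]
    simp only [hLapp]
    rw [integral_inner_mul_inner hη hC heig, if_pos rfl]
  have hmap : ∀ i : Fin d, μ.map (L i) = gaussianReal 0 (eig i).toNNReal := by
    intro i
    rw [IsGaussian.map_eq_gaussianReal, hμ, hvar]
  choose κ hκ0 hκ using fun i : Fin d =>
    exists_le_gaussianReal_Icc (v := (eig i).toNNReal) (by simpa using heig i)
  -- Each side of the box has length `(1 / 3) / n`.
  refine ⟨∏ i, κ i / 3, Finset.prod_pos fun i _ => by have := hκ0 i; positivity,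
    fun n hn j => ?_⟩
  have hn1 : (1 : ℝ) ≤ n := by exact_mod_cast hn
  have hn0 : (0 : ℝ) < n := by linarith
  let box : Fin d → Set ℝ := fun i => Set.Icc (((j i : ℕ) - 1 / 6) / n) (((j i : ℕ) + 1 / 6) / n)
  have hset : {x | ‖(n : ℝ) • coordMap Im η d x - latticePoint j‖ ≤ 1 / 6} =
      ⋂ i ∈ Finset.univ, L i ⁻¹' box i := by
    ext x
    simp only [Set.mem_ofPred_eq, pi_norm_le_iff_of_nonneg (by norm_num : (0 : ℝ) ≤ 1 / 6),
      Pi.sub_apply, Pi.smul_apply, smul_eq_mul, latticePoint, Real.norm_eq_abs, abs_le,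
      Finset.mem_univ, Set.iInter_true, Set.mem_iInter, Set.mem_preimage, box, Set.mem_Icc,
      div_le_iff₀ hn0, le_div_iff₀ hn0, coordMap_apply, hLapp]
    refine forall_congr' fun i => ?_
    constructor <;> rintro ⟨h1, h2⟩ <;> constructor <;> linarith
  have hbox : ∀ i, κ i / 3 / n ≤ μ.real (L i ⁻¹' box i) := by
    intro i
    have hji : ((j i : ℕ) : ℝ) + 1 ≤ n := by exact_mod_cast (j i).2
    have hji0 : (0 : ℝ) ≤ (j i : ℕ) := Nat.cast_nonneg _
    -- The sides lie in `[-1, 1]` because `0 ≤ j i ≤ n - 1`.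
    have h := hκ i (((j i : ℕ) - 1 / 6) / n) (((j i : ℕ) + 1 / 6) / n)
      (by rw [le_div_iff₀ hn0]; linarith) (by rw [div_le_iff₀ hn0]; linarith)
    rw [← hmap, Measure.map_apply (by fun_prop) measurableSet_Icc,
      ENNReal.ofReal_le_iff_le_toReal (measure_ne_top _ _)] at h
    refine le_trans (le_of_eq ?_) h
    ring
  rw [hset, measureReal_def, hind.measure_inter_preimage_eq_mul _ fun i _ => measurableSet_Icc,
    ENNReal.toReal_prod]
  calc (∏ i, κ i / 3) / n ^ d = ∏ i, κ i / 3 / n := by simp [Finset.prod_div_distrib]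
    _ ≤ _ := Finset.prod_le_prod (fun i _ => by have := hκ0 i; positivity) fun i _ => hbox i

end GaussianSmallBoxes

/-! ### Fooling functions and the query lower bound -/

section LowerBound

/-- A lower bound for the number of queries at all scales gives the corresponding power-law
lower bound. -/
lemma tendsto_rpow_mul_nhds_top {q : ℝ → ℝ≥0∞} {B : ℝ} (hB : 0 < B) {r d : ℕ} (hr : 1 ≤ r)
    (hq : ∀ n : ℕ, 1 ≤ n → ∀ ε, 0 < ε → ε ≤ B / n ^ (r + d) →
      ENNReal.ofReal ((n : ℝ) ^ d / 2) ≤ q ε)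
    {γ : ℝ} (hγ : γ * (r + d) < d) :
    Tendsto (fun ε : ℝ => ENNReal.ofReal (ε ^ γ) * q ε) (𝓝[>] 0) (𝓝 ⊤) := by
  have hrd : (0 : ℝ) < r + d := by
    have : (1 : ℝ) ≤ r := by exact_mod_cast hr
    positivity
  set θ : ℝ := d / (r + d) with hθ
  have hγθ : γ - θ < 0 := by rw [sub_neg, hθ, lt_div_iff₀ hrd]; exact hγ
  set C : ℝ := B ^ θ / 2 ^ d / 2 with hCdef
  have hC : 0 < C := by positivity
  have hlim : Tendsto (fun ε : ℝ => ENNReal.ofReal (C * ε ^ (γ - θ))) (𝓝[>] 0) (𝓝 ⊤) :=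
    ENNReal.tendsto_ofReal_atTop.comp ((tendsto_rpow_neg_nhdsGT_zero hγθ).const_mul_atTop hC)
  refine tendsto_nhds_top_mono hlim ?_
  filter_upwards [Ioc_mem_nhdsGT hB] with ε hε
  obtain ⟨hε0, hεB⟩ := hε
  -- The real scale with `t ^ (r + d) = B / ε`. Rounding it down to an integer costs at most a
  -- factor `2`, hence the `2 ^ d` in `C`.
  set t : ℝ := (B / ε) ^ ((r + d : ℝ)⁻¹) with ht
  have hBε : 1 ≤ B / ε := (one_le_div hε0).2 hεB
  have ht1 : 1 ≤ t := Real.one_le_rpow hBε (by positivity)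
  have htpow : t ^ (r + d) = B / ε := by
    rw [ht, ← Real.rpow_natCast, ← Real.rpow_mul (by positivity)]
    push_cast
    rw [inv_mul_cancel₀ hrd.ne', Real.rpow_one]
  have hn1 : 1 ≤ ⌊t⌋₊ := Nat.one_le_floor_iff t |>.2 ht1
  have hnt : (⌊t⌋₊ : ℝ) ≤ t := Nat.floor_le (by linarith)
  have htn : t / 2 ≤ ⌊t⌋₊ := by
    have h1 := Nat.lt_floor_add_one t
    have h2 : (1 : ℝ) ≤ ⌊t⌋₊ := by exact_mod_cast hn1
    linarith
  have hn0 : (0 : ℝ) < ⌊t⌋₊ := by exact_mod_cast hn1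
  have hεn : ε ≤ B / (⌊t⌋₊ : ℝ) ^ (r + d) := by
    rw [le_div_iff₀ (by positivity), mul_comm, ← le_div_iff₀ hε0, ← htpow]
    gcongr
  refine le_trans ?_ (mul_le_mul_right (hq _ hn1 ε hε0 hεn) _)
  rw [← ENNReal.ofReal_mul (by positivity)]
  refine ENNReal.ofReal_le_ofReal ?_
  have htd : t ^ d = B ^ θ * ε ^ (-θ) := by
    rw [ht, ← Real.rpow_natCast, ← Real.rpow_mul (by positivity), ← div_eq_inv_mul, ← hθ,
      Real.div_rpow hB.le hε0.le, Real.rpow_neg hε0.le, div_eq_mul_inv]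
  calc C * ε ^ (γ - θ) = ε ^ γ * ((t / 2) ^ d / 2) := by
        rw [div_pow, htd, sub_eq_add_neg, Real.rpow_add hε0]
        ring
    _ ≤ ε ^ γ * ((⌊t⌋₊ : ℝ) ^ d / 2) := by gcongr

variable {X : Type*} [NormedAddCommGroup X] [NormedSpace ℝ X]
    [TopologicalSpace.SeparableSpace X] [MeasurableSpace X] [BorelSpace X]
    {μ : Measure X} [IsGaussian μ]

/-- The quantum query lower bound on the scale `n` from the `d`-dimensional fooling functions. -/
theorem exists_pow_le_two_mul_queries (hμ : ∀ L : StrongDual ℝ X, ∫ x, L x ∂μ = 0)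
    {Im : X →L[ℝ] L2I} {η : ℕ → L2I} (hη : Orthonormal ℝ η)
    {eig : ℕ → ℝ} (hC : ∀ i, covarianceOperator (μ.map Im) (η i) = eig i • η i)
    (heig : ∀ i, 0 < eig i) {r : ℕ} (hr : 1 ≤ r) {K : ℕ → ℝ} (hK : ∀ i ≤ r, 0 < K i) (d : ℕ) :
    ∃ B : ℝ, 0 < B ∧ ∀ n : ℕ, 1 ≤ n → ∀ ε, ε ≤ B / n ^ (r + d) →
      ∀ A : QuantumAlgorithm X, A.Approximates (pathIntegral μ) (classF Im r K) ε →
        n ^ d ≤ 2 * A.queries := by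
  have : SecondCountableTopology X := UniformSpace.secondCountable_of_separable X
  obtain ⟨c, hc, hcμ⟩ := exists_le_measureReal_coordMap hμ hη hC heig d
  obtain ⟨M, hM, hMb⟩ := exists_norm_iteratedFDeriv_bump_le d r
  obtain ⟨i₀, hi₀, hmin⟩ := (Finset.range (r + 1)).exists_min_image K ⟨0, by simp⟩
  have hKi₀ : 0 < K i₀ := hK i₀ (by simpa [Nat.lt_succ_iff] using hi₀)
  set a : ℝ := K i₀ / (M * (1 + ‖Im‖) ^ r) with ha
  have ha0 : 0 < a := by positivity
  have haK : ∀ i ≤ r, a * M * (1 + ‖Im‖) ^ r ≤ K i := fun i hi => by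
    refine le_trans (le_of_eq ?_) (hmin i (by simpa [Nat.lt_succ_iff] using hi))
    rw [ha]
    field_simp
  -- With `w = a * c / n ^ (r + d)` this gives `ε ≤ w / 3`, so `2 * ε < w`.
  refine ⟨a * c / 3, by positivity, fun n hn ε hε A hA => ?_⟩
  have hn0 : (0 : ℝ) < n := by exact_mod_cast hn
  set P := coordMap Im η d with hPdef
  let bumpAt (j : Fin d → Fin n) (x : X) : ℝ := bump d ((n : ℝ) • P x - latticePoint j)
  have hint : ∀ j, Integrable (bumpAt j) μ := fun j => by
    have hcont : Continuous (bumpAt j) := (bump d).continuous.comp (by fun_prop)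
    refine Integrable.of_bound hcont.aestronglyMeasurable 1 (ae_of_all _ fun x => ?_)
    rw [Real.norm_of_nonneg (bump d).nonneg]
    exact (bump d).le_one
  let mass (j : Fin d → Fin n) : ℝ := ∫ x, bumpAt j x ∂μ
  have hmass : ∀ j, c / n ^ d ≤ mass j := fun j => by
    have hmeas : MeasurableSet {x | ‖(n : ℝ) • P x - latticePoint j‖ ≤ 1 / 6} :=
      (isClosed_le (by fun_prop) (by fun_prop)).measurableSet
    refine (hcμ n hn j).trans ?_
    rw [← integral_indicator_one hmeas]
    refine integral_mono ((integrable_const 1).indicator hmeas) (hint j) fun x => ?_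
    refine Set.indicator_le' (f := 1) (g := bumpAt j) (fun x hx => ?_)
      (fun x _ => (bump d).nonneg) x
    exact ((bump d).one_of_mem_closedBall (mem_closedBall_zero_iff.2 hx)).ge
  have hv : 0 < c / (n : ℝ) ^ d := by positivity
  -- The bumps have different masses. Scaling each down to the common lower bound `c / n ^ d` makes
  -- the integral depend on the weight alone.
  let coef (b : (Fin d → Fin n) → Bool) (j : Fin d → Fin n) : ℝ :=
    (b j).toNat * (c / n ^ d / mass j)
  have hcoef : ∀ b j, |coef b j| ≤ 1 := fun b j => by
    have h0 : 0 ≤ c / n ^ d / mass j := div_nonneg hv.le (hv.le.trans (hmass j))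
    have h1 : c / n ^ d / mass j ≤ 1 := (div_le_one (hv.trans_le (hmass j))).2 (hmass j)
    cases hb : b j <;> simp [coef, hb, abs_of_nonneg h0, h1]
  let f (b : (Fin d → Fin n) → Bool) (x : X) : ℝ :=
    a / n ^ r * latticeSum (coef b) ((n : ℝ) • P x)
  have hfF : ∀ b, f b ∈ classF Im r K := fun b =>
    rescaled_comp_mem_classF (norm_coordMap_le Im hη d) hr (contDiff_latticeSum _ r)
      (fun i hi y => norm_iteratedFDeriv_latticeSum_le (hcoef b) (hMb i hi) y) ha0.le haK hn
  have hfdep : ∀ x, ∃ s : Finset (Fin d → Fin n), s.card ≤ 1 ∧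
      DependsOn (fun b => f b x) (s : Set (Fin d → Fin n)) := fun x => by
    obtain ⟨s, hs, hsx⟩ := exists_card_le_one_forall_notMem n ((n : ℝ) • P x)
    refine ⟨s, hs, fun b b' hbb' => congrArg (a / n ^ r * ·) (Finset.sum_congr rfl fun j _ => ?_)⟩
    by_cases hj : j ∈ s
    · simp only [coef, hbb' j hj]
    · rw [image_eq_zero_of_notMem_tsupport (hsx j hj), mul_zero, mul_zero]
  have hfI : ∀ b, pathIntegral μ (f b) = a * c / n ^ (r + d) * weight b := fun b => by
    have hsum : ∫ x, latticeSum (coef b) ((n : ℝ) • P x) ∂μ = ∑ j, coef b j * mass j := by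
      simp only [mass, ← integral_const_mul]
      exact integral_finsetSum _ fun j _ => (hint j).const_mul _
    simp only [pathIntegral, f]
    rw [integral_const_mul, hsum, weight, Nat.cast_sum, Finset.mul_sum, Finset.mul_sum]
    refine Finset.sum_congr rfl fun j _ => ?_
    have := (hv.trans_le (hmass j)).ne'
    simp only [coef]
    field_simp
    ring
  have hcard := hA.card_le_two_mul_queries hfdep hfF hfI (by
    have : 0 < a * c / (n : ℝ) ^ (r + d) := by positivity
    have h3 : a * c / 3 / (n : ℝ) ^ (r + d) = a * c / (n : ℝ) ^ (r + d) / 3 := by ring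
    linarith)
  simpa using hcard

end LowerBound

end PathInt

theorem theorem3 {X : Type*} [NormedAddCommGroup X] [NormedSpace ℝ X] [CompleteSpace X]
    [TopologicalSpace.SeparableSpace X] [MeasurableSpace X] [BorelSpace X]
    (μ : Measure X) [IsGaussian μ] (hμ : ∀ L : StrongDual ℝ X, ∫ x, L x ∂μ = 0)
    (Im : X →L[ℝ] PathInt.L2I) (hIm : Function.Injective Im)
    (η : ℕ → PathInt.L2I) (hη : Orthonormal ℝ η) (eig : ℕ → ℝ)
    (hC : ∀ i, covarianceOperator (μ.map Im) (η i) = eig i • η i)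
    (heig : ∀ i, 0 < eig i)
    (r : ℕ) (hr : 1 ≤ r) (K : ℕ → ℝ) (hK : ∀ i ≤ r, 0 < K i)
    (α : ℝ) (hα : α ∈ Set.Ioo (0 : ℝ) 1) :
    Tendsto
      (fun ε : ℝ => ENNReal.ofReal (ε ^ (1 - α)) *
        ((PathInt.qq (PathInt.pathIntegral μ) (PathInt.classF Im r K) ε : ℕ∞) : ℝ≥0∞))
      (𝓝[>] 0) (𝓝 ⊤) := by
  -- Equivalent to `(1 - α) * (r + d) < d`.
  obtain ⟨d, hd⟩ := exists_nat_gt ((1 - α) * r / α)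
  obtain ⟨B, hB, hBq⟩ := PathInt.exists_pow_le_two_mul_queries hμ hη hC heig hr hK d
  refine PathInt.tendsto_rpow_mul_nhds_top (d := d) hB hr (fun n hn ε _ hε => ?_) ?_
  · have hqq : (((n ^ d + 1) / 2 : ℕ) : ℕ∞) ≤
        PathInt.qq (PathInt.pathIntegral μ) (PathInt.classF Im r K) ε :=
      le_iInf₂ fun A hA => by
        have := hBq n hn ε hε A hA
        exact_mod_cast (by omega : (n ^ d + 1) / 2 ≤ A.queries)
    refine le_trans ?_ (ENat.toENNReal_le.2 hqq)
    rw [ENat.toENNReal_coe, ← ENNReal.ofReal_natCast]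
    refine ENNReal.ofReal_le_ofReal ?_
    have h2 : n ^ d ≤ 2 * ((n ^ d + 1) / 2) := by omega
    have h2' : ((n : ℝ)) ^ d ≤ 2 * (((n ^ d + 1) / 2 : ℕ) : ℝ) := by exact_mod_cast h2
    linarith
  · rw [div_lt_iff₀ hα.1] at hd
    linarith
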